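/- Let $X$ be a countably infinite set and let $(X,m,b)$ be a connected weighted graph: $m\colon X\to(0,\infty)$, and $b\colon X\times X\to[0,\infty)$ is symmetric, vanishes on the diagonal and satisfies $\sum_{y\in X}b(x,y)<\infty$ for every $x\in X$; vertices $x,y$ are adjacent if $b(x,y)>0$, a set of vertices is connected if any two of its elements are joined by a finite path of adjacent vertices inside the set, and $X$ is connected. Let $p>1$ and let $c\colon X\to\mathbb R$ be arbitrary. For finitely supported $\varphi$, that is $\varphi\in C_c(X)$, put $$h(\varphi)=\tfrac12\sum_{x,y\in X}b(x,y)\,|\varphi(x)-\varphi(y)|^p+\sum_{x\in X}c(x)|\varphi(x)|^p .$$ For $V\subseteq X$ let $F(V)$ be the set of all $f\colon X\to\mathbb R$ with $\sum_{y}b(x,y)|f(x)-f(y)|^{p-1}<\infty$ for all $x\in V$, and for $f\in F(V)$, $x\in V$ let $$Hf(x)=\frac1{m(x)}\sum_{y\in X}b(x,y)\,|f(x)-f(y)|^{p-1}\operatorname{sgn}(f(x)-f(y))+\frac{c(x)}{m(x)}|f(x)|^{p-1}\operatorname{sgn}f(x).$$ A function $u\in F(V)$ is harmonic (superharmonic)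 on $V$ if $Hu=0$ ($Hu\ge0$) on $V$. A function is called positive if it is non-negative and not identically zero. Assume that $h(\varphi)\ge0$ for all $\varphi\in C_c(X)$. Use the following notions. - $h$ is critical in $X$ if there is no positive $w\colon X\to\mathbb R$ with $h(\varphi)\ge\sum_{x}|\varphi(x)|^pw(x)$ for all $\varphi\in C_c(X)$. - For finite $K\subseteq X$, $\mathcal M(X\setminus K)$ is the set of all positive functions $u$ on $X$ that are harmonic on $X\setminus K$ and have the following property: for every finite, connected, non-empty $\tilde K\subseteq X$ with $K\subseteq\tilde K$ and every positive $v\in F(X\setminus\tilde K)$ that is superharmonic on $X\setminus\tilde K$, if $u\le v$ on $\tilde K$, then $u\le v$ on $X\setminus\tilde K$. - A global minimal positive harmonic function in $X$ is an element of $\mathcal M(X)=\mathcal M(X\setminus\emptyset)$. - A normalised Green's function at $o\in X$ is a function $u\in\mathcal M(X\setminus\{o\})\cap F(X)$ that is not harmonic at $o$ and satisfies $Hu=1_o$ on $X$. - $\operatorname{cap}_h(x,X)=\inf\{h(\varphi):\varphi\in C_c(X),\ \varphi(x)=1\}$. - An Agmon ground state is a positive harmonic function $u$ on $X$ such that every positive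 superharmonic function on $X$ is a constant multiple of $u$. **Theorem.** The following statements are equivalent: 1. $h$ is critical in $X$. 2. For no $o\in X$ does there exist a normalised Green's function at $o$. 3. There exists a global minimal positive harmonic function in $X$. 4. $\operatorname{cap}_h(x,X)=0$ for some $x\in X$. Moreover, if $h$ is critical in $X$, then the global minimal positive harmonic functions in $X$ are exactly the Agmon ground states (so such a function is unique up to a positive factor). -/

import Mathlib

noncomputable section

/-- A connected weighted graph `(X, m, b)` : a strictly positive vertex weight `m`, and a symmetric,
non-negative, locally summable edge weight `b` with zero diagonal, such that any two vertices are
joined by a finite path of edges of positive weight. -/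
structure WeightedGraph (X : Type*) where
  /-- the vertex weight -/
  m : X → ℝ
  /-- the edge weight -/
  b : X → X → ℝ
  m_pos : ∀ x, 0 < m x
  b_nonneg : ∀ x y, 0 ≤ b x y
  b_symm : ∀ x y, b x y = b y x
  b_diag : ∀ x, b x x = 0
  b_summable : ∀ x, Summable (fun y => b x y)
  connected : ∀ x y, Relation.ReflTransGen (fun z w => 0 < b z w) x y

namespace WeightedGraph

variable {X : Type*}

/-- Vertices `x ∼ y`, i.e. `b x y > 0`, as a simple graph. -/
def toSimpleGraph (G : WeightedGraph X) : SimpleGraph X where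
  Adj x y := 0 < G.b x y
  symm := ⟨fun x y h => by rw [G.b_symm y x]; exact h⟩
  loopless := ⟨fun x h => by rw [G.b_diag x] at h; exact lt_irrefl _ h⟩

/-- `V` is connected: any two of its vertices are joined by a path inside `V`.
(The empty set is connected in this sense.) -/
def IsConnectedSet (G : WeightedGraph X) (V : Set X) : Prop :=
  (G.toSimpleGraph.induce V).Preconnected

/-- `∂V`, the vertices outside `V` that are connected to a vertex of `V`. -/
def boundary (G : WeightedGraph X) (V : Set X) : Set X :=
  {y | y ∉ V ∧ ∃ z ∈ V, 0 < G.b y z}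

end WeightedGraph

variable {X : Type*}

/-- `f` is positive on `I` : `f ≥ 0` on `I` and `f` is not identically zero on `I`. -/
def PositiveOn (I : Set X) (f : X → ℝ) : Prop :=
  (∀ x ∈ I, 0 ≤ f x) ∧ ∃ x ∈ I, f x ≠ 0

/-- `C_c(V)`, the finitely supported functions on `X` that vanish outside `V`. -/
def finSupp (V : Set X) : Set (X → ℝ) :=
  {φ | (Function.support φ).Finite ∧ Function.support φ ⊆ V}

/-- The signed power `|a|^(p-1) sgn a`. -/
def signedPow (p a : ℝ) : ℝ := |a| ^ (p - 1) * Real.sign a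

namespace WeightedGraph

/-- The formal space `F(V)`. -/
def formalSpace (G : WeightedGraph X) (p : ℝ) (V : Set X) : Set (X → ℝ) :=
  {f | ∀ x ∈ V, Summable (fun y => G.b x y * |f x - f y| ^ (p - 1))}

/-- The `p`-Laplacian `L`; the series converges absolutely at `x ∈ V` when `f ∈ F(V)`. -/
def laplacian (G : WeightedGraph X) (p : ℝ) (f : X → ℝ) (x : X) : ℝ :=
  (1 / G.m x) * ∑' y, G.b x y * signedPow p (f x - f y)

/-- The `p`-Schrödinger operator `H = L + (c / m) |·|^(p-1) sgn`. -/
def schrodinger (G : WeightedGraph X) (p : ℝ) (c : X → ℝ) (f : X → ℝ) (x : X) : ℝ :=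
  G.laplacian p f x + c x / G.m x * signedPow p (f x)

/-- `u ∈ F(V)` and `Hu = 0` on `V`. -/
def IsHarmonicOn (G : WeightedGraph X) (p : ℝ) (c : X → ℝ) (V : Set X) (u : X → ℝ) : Prop :=
  u ∈ G.formalSpace p V ∧ ∀ x ∈ V, G.schrodinger p c u x = 0

/-- `u ∈ F(V)` and `Hu ≥ 0` on `V`. -/
def IsSuperharmonicOn (G : WeightedGraph X) (p : ℝ) (c : X → ℝ) (V : Set X) (u : X → ℝ) : Prop :=
  u ∈ G.formalSpace p V ∧ ∀ x ∈ V, 0 ≤ G.schrodinger p c u x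

/-- The domain `D` of the energy functional. -/
def energyDomain (G : WeightedGraph X) (p : ℝ) (c : X → ℝ) : Set (X → ℝ) :=
  {f | Summable (fun z : X × X => G.b z.1 z.2 * |f z.1 - f z.2| ^ p) ∧
    Summable (fun x => |c x| * |f x| ^ p)}

/-- The `p`-energy functional `h`, meaningful on `D`, in particular on `C_c(X)`
(see `finSupp_subset_energyDomain`). -/
def energy (G : WeightedGraph X) (p : ℝ) (c : X → ℝ) (f : X → ℝ) : ℝ :=
  1 / 2 * ∑' z : X × X, G.b z.1 z.2 * |f z.1 - f z.2| ^ p + ∑' x, c x * |f x| ^ p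

theorem finSupp_subset_energyDomain (G : WeightedGraph X) {p : ℝ} (hp : 1 < p) (c : X → ℝ)
    (V : Set X) : finSupp V ⊆ G.energyDomain p c := by
  rintro f ⟨hf, -⟩
  have hp0 : (0 : ℝ) ≤ p := by linarith
  have hpne : p ≠ 0 := by linarith
  constructor
  · have key : ∀ g : X → ℝ, (Function.support g).Finite →
        Summable (fun z : X × X => G.b z.1 z.2 * |g z.1|) := by
      intro g hg
      have h0 : ∀ z : X × X, 0 ≤ G.b z.1 z.2 * |g z.1| :=
        fun z => mul_nonneg (G.b_nonneg _ _) (abs_nonneg _)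
      refine (summable_prod_of_nonneg h0).mpr ⟨fun x => (G.b_summable x).mul_right |g x|, ?_⟩
      refine summable_of_ne_finset_zero (s := hg.toFinset) ?_
      intro x hx
      have hx0 : g x = 0 := by simpa using hx
      simp [hx0]
    have k1 := key (fun x => 2 ^ p * |f x| ^ p) (hf.subset (fun x hx hx0 => by
      simp [hx0, Real.zero_rpow hpne] at hx))
    have k2 := (Equiv.prodComm X X).summable_iff.mpr k1
    refine Summable.of_nonneg_of_le
      (fun z => mul_nonneg (G.b_nonneg _ _) (Real.rpow_nonneg (abs_nonneg _) _)) ?_ (k1.add k2)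
    rintro ⟨x, y⟩
    simp only [Function.comp, Equiv.prodComm_apply, Prod.swap]
    rw [G.b_symm y x, ← mul_add]
    refine mul_le_mul_of_nonneg_left ?_ (G.b_nonneg _ _)
    have hx : 0 ≤ (2 : ℝ) ^ p * |f x| ^ p := by positivity
    have hy : 0 ≤ (2 : ℝ) ^ p * |f y| ^ p := by positivity
    rw [abs_of_nonneg hx, abs_of_nonneg hy]
    rcases le_total |f x| |f y| with h | h
    · have : |f x - f y| ^ p ≤ (2 * |f y|) ^ p :=
        Real.rpow_le_rpow (abs_nonneg _) (by linarith [abs_sub (f x) (f y)]) hp0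
      rw [Real.mul_rpow (by norm_num) (abs_nonneg _)] at this
      linarith
    · have : |f x - f y| ^ p ≤ (2 * |f x|) ^ p :=
        Real.rpow_le_rpow (abs_nonneg _) (by linarith [abs_sub (f x) (f y)]) hp0
      rw [Real.mul_rpow (by norm_num) (abs_nonneg _)] at this
      linarith
  · refine summable_of_ne_finset_zero (s := hf.toFinset) ?_
    intro x hx
    have hx0 : f x = 0 := by simpa using hx
    simp [hx0, Real.zero_rpow hpne]

/-- `h` is non-negative on `C_c(V)`. -/
def IsNonnegOn (G : WeightedGraph X) (p : ℝ) (c : X → ℝ) (V : Set X) : Prop :=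
  ∀ φ ∈ finSupp V, 0 ≤ G.energy p c φ

/-- `w` is a Hardy weight in `V` : `w` is positive and `h(φ) ≥ ∑ |φ(x)|^p w(x)` on `C_c(V)`. -/
def IsHardyWeight (G : WeightedGraph X) (p : ℝ) (c : X → ℝ) (V : Set X) (w : X → ℝ) : Prop :=
  PositiveOn V w ∧ ∀ φ ∈ finSupp V, ∑' x, |φ x| ^ p * w x ≤ G.energy p c φ

/-- `h` is critical in `V` : it is non-negative on `C_c(V)` and has no Hardy weight in `V`. -/
def IsCritical (G : WeightedGraph X) (p : ℝ) (c : X → ℝ) (V : Set X) : Prop :=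
  G.IsNonnegOn p c V ∧ ¬ ∃ w : X → ℝ, G.IsHardyWeight p c V w

/-- `u ∈ 𝓜(V \ K)` : `u` is a positive harmonic function of minimal growth in a neighbourhood of
infinity in `V` (for connected `V` and finite `K ⊆ V`). The comparison sets `K'` are non-empty. -/
def IsMinimalGrowth (G : WeightedGraph X) (p : ℝ) (c : X → ℝ) (V K : Set X) (u : X → ℝ) : Prop :=
  G.IsHarmonicOn p c (V \ K) u ∧ PositiveOn (V ∪ G.boundary V) u ∧
    ∀ K' : Set X, K'.Finite → K'.Nonempty → G.IsConnectedSet K' → K' ⊆ V → K ⊆ K' →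
      ∀ v : X → ℝ, PositiveOn Set.univ v → G.IsSuperharmonicOn p c (V \ K') v →
        (∀ x ∈ K', u x ≤ v x) → ∀ x ∈ V \ K', u x ≤ v x

/-- `u ∈ 𝓜(V)` : `u` is a global minimal positive harmonic function in `V`. -/
def IsGlobalMinimal (G : WeightedGraph X) (p : ℝ) (c : X → ℝ) (V : Set X) (u : X → ℝ) : Prop :=
  G.IsMinimalGrowth p c V ∅ u

/-- `u` is a (global minimal positive) Green's function in `V` at `o`. -/
def IsGreenFunction (G : WeightedGraph X) (p : ℝ) (c : X → ℝ) (V : Set X) (o : X)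
    (u : X → ℝ) : Prop :=
  G.IsMinimalGrowth p c V {o} u ∧ u ∈ G.formalSpace p V ∧ ¬ G.IsHarmonicOn p c {o} u

/-- `u` is a normalised Green's function in `V` at `o` : moreover `Hu = 1_o` on `V`. -/
def IsNormalisedGreenFunction (G : WeightedGraph X) (p : ℝ) (c : X → ℝ) (V : Set X) (o : X)
    (u : X → ℝ) : Prop :=
  G.IsGreenFunction p c V o u ∧
    ∀ x ∈ V, G.schrodinger p c u x = Set.indicator {o} (fun _ => (1 : ℝ)) x

/-- The variational `p`-capacity of `x` in `V`, the infimum of `h(φ)` over the `φ ∈ C_c(V)` with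
`φ(x) = 1`. For `x ∈ V` and `h` non-negative on `C_c(V)` it is taken over a non-empty set of reals
that is bounded below by zero. -/
def capacity (G : WeightedGraph X) (p : ℝ) (c : X → ℝ) (x : X) (V : Set X) : ℝ :=
  sInf (G.energy p c '' {φ | φ ∈ finSupp V ∧ φ x = 1})

/-- `u` is an Agmon ground state: a positive harmonic function on `X` such that every positive
superharmonic function on `X` is a constant multiple of `u`. -/
def IsAgmonGroundState (G : WeightedGraph X) (p : ℝ) (c : X → ℝ) (u : X → ℝ) : Prop :=
  PositiveOn Set.univ u ∧ G.IsHarmonicOn p c Set.univ u ∧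
    ∀ v : X → ℝ, PositiveOn Set.univ v → G.IsSuperharmonicOn p c Set.univ v →
      ∃ a : ℝ, ∀ x, v x = a * u x

end WeightedGraph

end

/-! The whole argument rests on touching: if `u ≤ v` with equality at `x` and `Hu(x) ≤ Hv(x)`, then
`u = v` at all neighbours of `x`, because the series defining `Hu(x)` dominates that of `Hv(x)` term
by term (`eq_of_touching`). On a connected graph the equality spreads. This gives strict positivity
of positive superharmonic functions, and, applied to `u` and `t v` with `t` the maximum of `u / v`,
the comparison principle on finite sets (`comparison`), with no sign condition on the potential `c`.

The second ingredient is the equilibrium potential of a vertex `o` (`exists_potential`). On a finite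
set `K` containing `o` the energy is coercive, so it has a minimiser `u_K` among the functions
supported in `K` with value `1` at `o`. By comparison `u_K` increases along an exhaustion, by the
Harnack inequality (`exists_le_of_adj`) it stays bounded, and `H` passes to the limit
(`tendsto_schrodinger`). The limit `u` is strictly positive with `u(o) = 1`, satisfies
`m(o) Hu = cap(o) 1_o`, and comparison of `u_K` with superharmonic functions shows that it has
minimal growth off `o`.

If `cap(o) > 0`, a multiple of `u` is a normalised Green's function, and `cap(o) 1_o` is a Hardy
weight by homogeneity. If `cap(o) = 0`, then `u` is harmonic and, by minimality and touching at `o`,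
every positive superharmonic function is a multiple of it: it is an Agmon ground state. As soon as
there is an Agmon ground state, it is a multiple of the equilibrium potential of every vertex. Hence
all capacities vanish, there is no Hardy weight and no Green's function, and the ground state has
minimal growth off every vertex, so it is a global minimal positive harmonic function. Conversely,
a global minimal positive harmonic function is an Agmon ground state, again by touching at a
vertex. -/

noncomputable section

variable {X : Type*}

/-! ### The signed power -/

theorem signedPow_zero {p : ℝ} : signedPow p 0 = 0 := by simp [signedPow]

theorem signedPow_of_nonneg {p : ℝ} (hp : 1 < p) {a : ℝ} (ha : 0 ≤ a) :
    signedPow p a = a ^ (p - 1) := by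
  rcases ha.eq_or_lt with rfl | h
  · rw [signedPow_zero, Real.zero_rpow (by linarith)]
  · rw [signedPow, abs_of_pos h, Real.sign_of_pos h, mul_one]

theorem signedPow_neg (p a : ℝ) : signedPow p (-a) = -signedPow p a := by
  rw [signedPow, signedPow, abs_neg, Real.sign_neg, mul_neg]

theorem abs_signedPow {p : ℝ} (hp : 1 < p) (a : ℝ) : |signedPow p a| = |a| ^ (p - 1) := by
  rcases le_total 0 a with h | h
  · rw [signedPow_of_nonneg hp h, abs_of_nonneg h, abs_of_nonneg (by positivity)]
  · obtain ⟨b, rfl⟩ : ∃ b, a = -b := ⟨-a, by ring⟩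
    have hb : 0 ≤ b := by linarith
    rw [signedPow_neg, abs_neg, abs_neg, signedPow_of_nonneg hp hb, abs_of_nonneg hb,
      abs_of_nonneg (by positivity)]

theorem signedPow_eq_sub {p : ℝ} (hp : 1 < p) (a : ℝ) :
    signedPow p a = (max a 0) ^ (p - 1) - (max (-a) 0) ^ (p - 1) := by
  have h0 : (0 : ℝ) ^ (p - 1) = 0 := Real.zero_rpow (by linarith)
  rcases le_total 0 a with h | h
  · rw [signedPow_of_nonneg hp h, max_eq_left h, max_eq_right (by linarith), h0, sub_zero]
  · have := signedPow_of_nonneg hp (a := -a) (by linarith)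
    rw [signedPow_neg] at this
    rw [max_eq_right h, max_eq_left (by linarith), h0, ← this]; ring

theorem continuous_signedPow {p : ℝ} (hp : 1 < p) : Continuous (signedPow p) := by
  have h : signedPow p = fun a => (max a 0) ^ (p - 1) - (max (-a) 0) ^ (p - 1) :=
    funext (signedPow_eq_sub hp)
  have hr := Real.continuous_rpow_const (q := p - 1) (by linarith)
  rw [h]
  exact (hr.comp (by fun_prop : Continuous fun a : ℝ => max a 0)).sub
    (hr.comp (by fun_prop : Continuous fun a : ℝ => max (-a) 0))

theorem signedPow_strictMono {p : ℝ} (hp : 1 < p) : StrictMono (signedPow p) := by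
  have hp' : 0 < p - 1 := by linarith
  intro a b hab
  rcases le_or_gt 0 a with ha | ha
  · rw [signedPow_of_nonneg hp ha, signedPow_of_nonneg hp (ha.trans hab.le)]
    exact Real.rpow_lt_rpow ha hab hp'
  · have e : signedPow p a = -(-a) ^ (p - 1) := by
      rw [← signedPow_of_nonneg hp (by linarith : 0 ≤ -a), signedPow_neg, neg_neg]
    rcases le_or_gt 0 b with hb | hb
    · rw [e, signedPow_of_nonneg hp hb]
      have h1 : 0 < (-a) ^ (p - 1) := Real.rpow_pos_of_pos (by linarith) _
      have h2 : 0 ≤ b ^ (p - 1) := Real.rpow_nonneg hb _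
      linarith
    · have e' : signedPow p b = -(-b) ^ (p - 1) := by
        rw [← signedPow_of_nonneg hp (by linarith : 0 ≤ -b), signedPow_neg, neg_neg]
      rw [e, e', neg_lt_neg_iff]
      exact Real.rpow_lt_rpow (by linarith) (by linarith) hp'

theorem signedPow_mul {p : ℝ} {t : ℝ} (ht : 0 < t) (a : ℝ) :
    signedPow p (t * a) = t ^ (p - 1) * signedPow p a := by
  have hs : Real.sign (t * a) = Real.sign a := by
    rcases lt_trichotomy a 0 with h | rfl | h
    · rw [Real.sign_of_neg h, Real.sign_of_neg (mul_neg_of_pos_of_neg ht h)]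
    · simp
    · rw [Real.sign_of_pos h, Real.sign_of_pos (mul_pos ht h)]
  rw [signedPow, signedPow, hs, abs_mul, abs_of_pos ht, Real.mul_rpow ht.le (abs_nonneg a), mul_assoc]

theorem hasDerivAt_abs_rpow_signedPow {p : ℝ} (hp : 1 < p) (a : ℝ) :
    HasDerivAt (fun x : ℝ => |x| ^ p) (p * signedPow p a) a := by
  have h := hasDerivAt_abs_rpow a hp
  convert h using 1
  rw [mul_assoc]
  congr 1
  rcases eq_or_ne a 0 with rfl | ha
  · simp [signedPow_zero]
  · rw [signedPow, show p - 1 = (p - 2) + 1 by ring, Real.rpow_add_one (abs_ne_zero.2 ha), mul_assoc]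
    congr 1
    rcases lt_or_gt_of_ne ha with h | h
    · rw [abs_of_neg h, Real.sign_of_neg h]; ring
    · rw [abs_of_pos h, Real.sign_of_pos h]; ring

namespace WeightedGraph

/-! ### Pointwise properties of the Schrödinger operator -/

/-- The `b`-degree `∑_y b(x, y)` of a vertex. -/
def totalWeight (G : WeightedGraph X) (x : X) : ℝ := ∑' y, G.b x y

theorem m_mul_schrodinger (G : WeightedGraph X) (p : ℝ) (c : X → ℝ) (u : X → ℝ) (x : X) :
    G.m x * G.schrodinger p c u x =
      ∑' y, G.b x y * signedPow p (u x - u y) + c x * signedPow p (u x) := by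
  have := (G.m_pos x).ne'
  rw [schrodinger, laplacian]
  field_simp

theorem summable_signedPow (G : WeightedGraph X) {p : ℝ} (hp : 1 < p) {u : X → ℝ} {x : X}
    (hu : Summable fun y => G.b x y * |u x - u y| ^ (p - 1)) :
    Summable fun y => G.b x y * signedPow p (u x - u y) := by
  refine Summable.of_norm (hu.congr fun y => ?_)
  rw [Real.norm_eq_abs, abs_mul, abs_of_nonneg (G.b_nonneg x y), abs_signedPow hp]

theorem formalSpace_mono (G : WeightedGraph X) (p : ℝ) {V W : Set X} (h : V ⊆ W) :
    G.formalSpace p W ⊆ G.formalSpace p V := fun _ hf x hx => hf x (h hx)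

theorem IsSuperharmonicOn.mono {G : WeightedGraph X} {p : ℝ} {c : X → ℝ} {V W : Set X}
    {u : X → ℝ} (hu : G.IsSuperharmonicOn p c W u) (h : V ⊆ W) : G.IsSuperharmonicOn p c V u :=
  ⟨G.formalSpace_mono p h hu.1, fun x hx => hu.2 x (h hx)⟩

theorem IsHarmonicOn.isSuperharmonicOn {G : WeightedGraph X} {p : ℝ} {c : X → ℝ} {V : Set X}
    {u : X → ℝ} (hu : G.IsHarmonicOn p c V u) : G.IsSuperharmonicOn p c V u :=
  ⟨hu.1, fun x hx => (hu.2 x hx).ge⟩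

theorem mul_mem_formalSpace {G : WeightedGraph X} {p : ℝ} {V : Set X} {u : X → ℝ}
    (hu : u ∈ G.formalSpace p V) (t : ℝ) : (fun x => t * u x) ∈ G.formalSpace p V := by
  intro x hx
  refine ((hu x hx).mul_left (|t| ^ (p - 1))).congr fun y => ?_
  rw [← mul_sub, abs_mul, Real.mul_rpow (abs_nonneg _) (abs_nonneg _)]
  ring

theorem schrodinger_mul (G : WeightedGraph X) (p : ℝ) (c : X → ℝ) {t : ℝ} (ht : 0 < t)
    (u : X → ℝ) (x : X) :
    G.schrodinger p c (fun x => t * u x) x = t ^ (p - 1) * G.schrodinger p c u x := by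
  simp only [schrodinger, laplacian, ← mul_sub, signedPow_mul ht]
  have : ∀ y, G.b x y * (t ^ (p - 1) * signedPow p (u x - u y)) =
      t ^ (p - 1) * (G.b x y * signedPow p (u x - u y)) := fun y => by ring
  simp only [this, tsum_mul_left]
  ring

theorem IsSuperharmonicOn.const_mul {G : WeightedGraph X} {p : ℝ} {c : X → ℝ} {V : Set X}
    {u : X → ℝ} (hu : G.IsSuperharmonicOn p c V u) {t : ℝ} (ht : 0 < t) :
    G.IsSuperharmonicOn p c V fun x => t * u x :=
  ⟨mul_mem_formalSpace hu.1 t, fun x hx => by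
    rw [schrodinger_mul _ _ _ ht]
    exact mul_nonneg (by positivity) (hu.2 x hx)⟩

theorem _root_.PositiveOn.const_mul {V : Set X} {u : X → ℝ} (hu : PositiveOn V u) {t : ℝ}
    (ht : 0 < t) : PositiveOn V fun x => t * u x := by
  obtain ⟨h0, x, hx, hne⟩ := hu
  exact ⟨fun x hx => mul_nonneg ht.le (h0 x hx), x, hx, mul_ne_zero ht.ne' hne⟩

/-! ### Touching and comparison -/

/-- If `u ≤ v` touch at `x` and `Hu(x) ≤ Hv(x)`, then they touch at every neighbour of `x`:
the series of `Hu(x)` dominates that of `Hv(x)` term by term. -/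
theorem eq_of_touching (G : WeightedGraph X) {p : ℝ} (hp : 1 < p) {c : X → ℝ} {u v : X → ℝ} {x y : X}
    (hu : u ∈ G.formalSpace p {x}) (hv : v ∈ G.formalSpace p {x}) (huv : ∀ z, u z ≤ v z)
    (hx : u x = v x) (hH : G.schrodinger p c u x ≤ G.schrodinger p c v x) (hy : 0 < G.b x y) :
    u y = v y := by
  by_contra hne
  have hlt : u y < v y := lt_of_le_of_ne (huv y) hne
  have h1 := mul_le_mul_of_nonneg_left hH (G.m_pos x).le
  rw [m_mul_schrodinger, m_mul_schrodinger, hx] at h1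
  have h2 : ∑' z, G.b x z * signedPow p (v x - v z) < ∑' z, G.b x z * signedPow p (u x - u z) := by
    refine Summable.tsum_lt_tsum (i := y) (fun z => ?_) ?_
      (G.summable_signedPow hp (hv x rfl)) (G.summable_signedPow hp (hu x rfl))
    · exact mul_le_mul_of_nonneg_left ((signedPow_strictMono hp).monotone
        (by rw [hx]; linarith [huv z])) (G.b_nonneg x z)
    · exact mul_lt_mul_of_pos_left (signedPow_strictMono hp (by rw [hx]; linarith)) hy
  rw [hx] at h2
  linarith

/-- A superharmonic function vanishing at `x` vanishes at the neighbours of `x`. -/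
theorem eq_zero_of_eq_zero (G : WeightedGraph X) {p : ℝ} (hp : 1 < p) {c : X → ℝ} {v : X → ℝ}
    {x y : X} (h0 : ∀ z, 0 ≤ v z) (hv : G.IsSuperharmonicOn p c {x} v) (hx : v x = 0)
    (hy : 0 < G.b x y) : v y = 0 := by
  have hp' : p - 1 ≠ 0 := by linarith
  refine (G.eq_of_touching hp (c := c) (u := fun _ => 0) (fun z _ => ?_) hv.1 h0 hx.symm ?_ hy).symm
  · simp [Real.zero_rpow hp']
  · simpa [schrodinger, laplacian, signedPow_zero] using hv.2 x rfl

/-- Minimum principle: a positive function that is superharmonic off `K` and strictly positive on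
`K` vanishes nowhere, as a zero would spread along paths. -/
theorem pos_of_isSuperharmonicOn (G : WeightedGraph X) {p : ℝ} (hp : 1 < p) {c : X → ℝ}
    {v : X → ℝ} {K : Set X} (hv0 : PositiveOn Set.univ v) (hv : G.IsSuperharmonicOn p c (Set.univ \ K) v)
    (hK : ∀ x ∈ K, 0 < v x) (x : X) : 0 < v x := by
  obtain ⟨h0, z, -, hz⟩ := hv0
  have h0' : ∀ y, 0 ≤ v y := fun y => h0 y trivial
  refine lt_of_le_of_ne (h0' x) fun hx => hz ?_
  have hpath : ∀ y, Relation.ReflTransGen (fun a d => 0 < G.b a d) x y → v y = 0 := by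
    intro y hxy
    induction hxy with
    | refl => exact hx.symm
    | @tail a d _ had ih =>
      have haK : a ∉ K := fun h => (hK a h).ne' ih
      exact G.eq_zero_of_eq_zero hp h0' (hv.mono (by simpa using haK)) ih had
  exact hpath z (G.connected x z)

theorem eq_of_touching_everywhere (G : WeightedGraph X) {p : ℝ} (hp : 1 < p) {c : X → ℝ}
    {u v : X → ℝ} {o : X} (hu : u ∈ G.formalSpace p Set.univ) (hv : v ∈ G.formalSpace p Set.univ)
    (huv : ∀ z, u z ≤ v z) (ho : u o = v o)
    (hH : ∀ x, G.schrodinger p c u x ≤ G.schrodinger p c v x) (x : X) : u x = v x := by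
  induction G.connected o x with
  | refl => exact ho
  | tail _ hbc ih =>
    exact G.eq_of_touching hp (G.formalSpace_mono p (Set.subset_univ _) hu)
      (G.formalSpace_mono p (Set.subset_univ _) hv) huv ih (hH _) hbc

/-- Comparison principle on a finite set `K`. Let `t` be the maximum of `u / v` on `K`. If `t > 1`,
then `u` and `t v` touch in `K`, hence along every path of vertices with `v > 0`, up to its first
exit from `K`; but there `u ≤ v < t v`. -/
theorem comparison (G : WeightedGraph X) {p : ℝ} (hp : 1 < p) {c : X → ℝ} {u v : X → ℝ} {K : Set X}
    (hK : K.Finite) (hu : u ∈ G.formalSpace p K) (hHu : ∀ x ∈ K, G.schrodinger p c u x ≤ 0)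
    (hv : G.IsSuperharmonicOn p c K v) (hv0 : ∀ x, 0 ≤ v x) (hvK : ∀ x ∈ K, 0 < v x)
    (huv : ∀ x ∉ K, u x ≤ v x)
    (hexit : ∀ x ∈ K, ∃ z ∉ K, Relation.ReflTransGen (fun a d => 0 < G.b a d ∧ 0 < v d) x z)
    (x : X) : u x ≤ v x := by
  by_contra! hlt
  have hxK : x ∈ K := by
    by_contra h
    exact absurd (huv x h) (not_le.2 hlt)
  obtain ⟨a, haK, hmax⟩ := Set.exists_max_image K (fun y => u y / v y) hK ⟨x, hxK⟩
  set t := u a / v a with ht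
  have ht1 : 1 < t := lt_of_lt_of_le ((one_lt_div (hvK x hxK)).2 hlt) (hmax x hxK)
  have ht0 : 0 < t := by linarith
  have hle : ∀ y, u y ≤ t * v y := by
    intro y
    by_cases hy : y ∈ K
    · exact (div_le_iff₀ (hvK y hy)).1 (hmax y hy)
    · nlinarith [huv y hy, hv0 y]
  obtain ⟨z, hzK, haz⟩ := hexit a haK
  suffices z ∈ K ∧ u z = t * v z from hzK this.1
  clear hzK
  induction haz with
  | refl => exact ⟨haK, by rw [ht, div_mul_cancel₀ _ (hvK a haK).ne']⟩
  | tail _ hde ih =>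
    rename_i d e _
    obtain ⟨hdK, hd⟩ := ih
    have hsub : ({d} : Set X) ⊆ K := by simpa using hdK
    have hs := (hv.mono hsub).const_mul ht0
    have he := G.eq_of_touching hp (G.formalSpace_mono p hsub hu) hs.1 hle hd
      ((hHu d hdK).trans (hs.2 d rfl)) hde.1
    refine ⟨?_, he⟩
    by_contra h
    have := huv e h
    nlinarith [hde.2]

/-! ### Local bounds and monotone limits -/

theorem totalWeight_nonneg (G : WeightedGraph X) (x : X) : 0 ≤ G.totalWeight x :=
  tsum_nonneg fun y => G.b_nonneg x y

/-- The series defining `Hu(x)` is bounded in terms of `u(x)` alone if `Hu(x) ≥ 0`, since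
`|a|^(p-1) = 2 (a⁺)^(p-1) - |a|^(p-1) sgn a` and `(u(x) - u(y))⁺ ≤ u(x)`. -/
theorem tsum_abs_sub_rpow_le (G : WeightedGraph X) {p : ℝ} (hp : 1 < p) {c : X → ℝ} {u : X → ℝ}
    {x : X} {M : ℝ} (h0 : ∀ z, 0 ≤ u z) (hu : G.IsSuperharmonicOn p c {x} u) (hM : u x ≤ M) :
    ∑' y, G.b x y * |u x - u y| ^ (p - 1) ≤ (2 * G.totalWeight x + |c x|) * M ^ (p - 1) := by
  have hp' : 0 ≤ p - 1 := by linarith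
  have h1 := mul_nonneg (G.m_pos x).le (hu.2 x rfl)
  rw [m_mul_schrodinger, signedPow_of_nonneg hp (h0 x)] at h1
  have hs := hu.1 x rfl
  have hs' := G.summable_signedPow hp hs
  have hb := (G.b_summable x).mul_right (2 * u x ^ (p - 1))
  have h2 : ∑' y, G.b x y * |u x - u y| ^ (p - 1) + ∑' y, G.b x y * signedPow p (u x - u y) ≤
      ∑' y, G.b x y * (2 * u x ^ (p - 1)) := by
    rw [← hs.tsum_add hs']
    refine (hs.add hs').tsum_le_tsum (fun y => ?_) hb
    rw [← mul_add]
    refine mul_le_mul_of_nonneg_left ?_ (G.b_nonneg x y)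
    rcases le_total 0 (u x - u y) with h | h
    · rw [signedPow_of_nonneg hp h, abs_of_nonneg h]
      linarith [Real.rpow_le_rpow h (by linarith [h0 y] : u x - u y ≤ u x) hp']
    · have e : signedPow p (u x - u y) = -|u x - u y| ^ (p - 1) := by
        rw [abs_of_nonpos h, ← signedPow_of_nonneg hp (by linarith : 0 ≤ -(u x - u y)),
          signedPow_neg, neg_neg]
      rw [e]
      linarith [Real.rpow_nonneg (h0 x) (p - 1)]
  rw [tsum_mul_right] at h2
  have h3 : u x ^ (p - 1) ≤ M ^ (p - 1) := Real.rpow_le_rpow (h0 x) hM hp'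
  have h4 := G.totalWeight_nonneg x
  have h5 : c x * u x ^ (p - 1) ≤ |c x| * u x ^ (p - 1) :=
    mul_le_mul_of_nonneg_right (le_abs_self _) (Real.rpow_nonneg (h0 x) _)
  have h6 := mul_le_mul_of_nonneg_left h3 (add_nonneg (mul_nonneg zero_le_two h4) (abs_nonneg (c x)))
  simp only [totalWeight] at *
  linarith

/-- Harnack inequality: a bound at `x` for non-negative functions that are superharmonic at `x`
gives a bound at each neighbour. -/
theorem exists_le_of_adj (G : WeightedGraph X) {p : ℝ} (hp : 1 < p) (c : X → ℝ) {x y : X}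
    (hxy : 0 < G.b x y) (M : ℝ) : ∃ M', ∀ u : X → ℝ, (∀ z, 0 ≤ u z) →
      G.IsSuperharmonicOn p c {x} u → u x ≤ M → u y ≤ M' := by
  set B := (2 * G.totalWeight x + |c x|) * M ^ (p - 1) with hB
  refine ⟨M + (B / G.b x y) ^ (p - 1)⁻¹, fun u h0 hu hM => ?_⟩
  have hp' : 0 < p - 1 := by linarith
  have h1 := G.tsum_abs_sub_rpow_le hp h0 hu hM
  have h2 : G.b x y * |u x - u y| ^ (p - 1) ≤ B :=
    ((hu.1 x rfl).le_tsum y fun z _ =>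
      mul_nonneg (G.b_nonneg x z) (Real.rpow_nonneg (abs_nonneg _) _)).trans h1
  have h3 : |u x - u y| ^ (p - 1) ≤ B / G.b x y := (le_div_iff₀' hxy).2 h2
  have h4 : |u x - u y| ≤ (B / G.b x y) ^ (p - 1)⁻¹ := by
    rw [← Real.rpow_rpow_inv (abs_nonneg (u x - u y)) hp'.ne']
    exact Real.rpow_le_rpow (by positivity) h3 (by positivity)
  have := neg_abs_le (u x - u y)
  linarith

open Filter Topology in
/-- For an increasing pointwise convergent sequence of non-negative functions, eventually
superharmonic at `x`, the operator `H` commutes with the limit at `x`: the uniform bound of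
`tsum_abs_sub_rpow_le` passes to the limit, and monotonicity then provides a summable majorant. -/
theorem tendsto_schrodinger (G : WeightedGraph X) {p : ℝ} (hp : 1 < p) {c : X → ℝ} {x : X}
    {u : ℕ → X → ℝ} {w : X → ℝ} (h0 : ∀ n z, 0 ≤ u n z) (hle : ∀ n z, u n z ≤ w z)
    (hlim : ∀ z, Tendsto (fun n => u n z) atTop (𝓝 (w z)))
    (hu : ∀ᶠ n in atTop, G.IsSuperharmonicOn p c {x} (u n)) :
    w ∈ G.formalSpace p {x} ∧
      Tendsto (fun n => G.schrodinger p c (u n) x) atTop (𝓝 (G.schrodinger p c w x)) := by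
  have hp' : 0 ≤ p - 1 := by linarith
  have hterm : ∀ (v : X → ℝ) (y : X), 0 ≤ G.b x y * |v x - v y| ^ (p - 1) := fun v y =>
    mul_nonneg (G.b_nonneg x y) (Real.rpow_nonneg (abs_nonneg _) _)
  have hw : Summable fun y => G.b x y * |w x - w y| ^ (p - 1) := by
    refine summable_of_sum_le (c := (2 * G.totalWeight x + |c x|) * w x ^ (p - 1)) (hterm w)
      fun s => ?_
    have ht : Tendsto (fun n => ∑ y ∈ s, G.b x y * |u n x - u n y| ^ (p - 1)) atTop
        (𝓝 (∑ y ∈ s, G.b x y * |w x - w y| ^ (p - 1))) :=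
      tendsto_finsetSum _ fun y _ =>
        ((((hlim x).sub (hlim y)).abs).rpow_const (Or.inr hp')).const_mul _
    refine le_of_tendsto ht ?_
    filter_upwards [hu] with n hn
    exact ((hn.1 x rfl).sum_le_tsum s fun y _ => hterm (u n) y).trans
      (G.tsum_abs_sub_rpow_le hp (h0 n) hn (hle n x))
  refine ⟨fun y hy => by rw [Set.mem_singleton_iff] at hy; subst hy; exact hw, ?_⟩
  have hbound : Summable fun y => G.b x y * (2 ^ (p - 1) * w x ^ (p - 1)) +
      2 ^ (p - 1) * (G.b x y * |w x - w y| ^ (p - 1)) :=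
    ((G.b_summable x).mul_right _).add (hw.mul_left _)
  have hsp := continuous_signedPow hp
  have hw0 : ∀ z, 0 ≤ w z := fun z => (h0 0 z).trans (hle 0 z)
  have hL : Tendsto (fun n => ∑' y, G.b x y * signedPow p (u n x - u n y)) atTop
      (𝓝 (∑' y, G.b x y * signedPow p (w x - w y))) := by
    refine tendsto_tsum_of_dominated_convergence hbound
      (fun y => ((hsp.tendsto _).comp ((hlim x).sub (hlim y))).const_mul _)
      (Eventually.of_forall fun n y => ?_)
    rw [Real.norm_eq_abs, abs_mul, abs_of_nonneg (G.b_nonneg x y), abs_signedPow hp]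
    have hA : 0 ≤ (2 : ℝ) ^ (p - 1) * w x ^ (p - 1) :=
      mul_nonneg (by positivity) (Real.rpow_nonneg (hw0 x) _)
    have hB : 0 ≤ (2 : ℝ) ^ (p - 1) * |w x - w y| ^ (p - 1) := by positivity
    have key : |u n x - u n y| ^ (p - 1) ≤
        2 ^ (p - 1) * w x ^ (p - 1) + 2 ^ (p - 1) * |w x - w y| ^ (p - 1) := by
      have h1 : |u n x - u n y| ≤ w x + |w x - w y| := by
        rw [abs_le]
        constructor <;> linarith [h0 n x, h0 n y, hle n x, hle n y, neg_abs_le (w x - w y),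
          abs_nonneg (w x - w y)]
      rcases le_total (w x) |w x - w y| with h | h
      · have := Real.rpow_le_rpow (abs_nonneg _) (h1.trans (by linarith : _ ≤ 2 * |w x - w y|)) hp'
        rw [Real.mul_rpow zero_le_two (abs_nonneg _)] at this
        linarith
      · have := Real.rpow_le_rpow (abs_nonneg _) (h1.trans (by linarith : _ ≤ 2 * w x)) hp'
        rw [Real.mul_rpow zero_le_two (hw0 x)] at this
        linarith
    calc _ ≤ G.b x y * _ := mul_le_mul_of_nonneg_left key (G.b_nonneg x y)
      _ = _ := by ring
  exact (hL.const_mul (1 / G.m x)).add (((hsp.tendsto _).comp (hlim x)).const_mul _)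

/-! ### The energy on finitely supported functions -/

theorem hasSum_mul_fst (G : WeightedGraph X) {g : X → ℝ} {K : Finset X} (hg : ∀ x ∉ K, g x = 0) :
    HasSum (fun z : X × X => G.b z.1 z.2 * g z.1) (∑ x ∈ K, G.totalWeight x * g x) := by
  have hs : Summable fun z : X × X => G.b z.1 z.2 * g z.1 := by
    refine Summable.of_norm ((summable_prod_of_nonneg fun z => norm_nonneg _).2
      ⟨fun x => ((G.b_summable x).mul_right (g x)).norm, ?_⟩)
    refine summable_of_ne_finset_zero (s := K) fun x hx => ?_
    simp [hg x hx]
  have h := hs.hasSum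
  rw [hs.tsum_prod] at h
  simp only [tsum_mul_right] at h
  rwa [tsum_eq_sum (s := K) fun x hx => by rw [hg x hx, mul_zero]] at h

/-- The energy of a function supported in `K`, as a finite sum over `K`. -/
def finiteEnergy (G : WeightedGraph X) (p : ℝ) (c : X → ℝ) (K : Finset X) (f : X → ℝ) : ℝ :=
  1 / 2 * ∑ z ∈ K ×ˢ K, G.b z.1 z.2 * (|f z.1 - f z.2| ^ p - |f z.1| ^ p - |f z.2| ^ p) +
    ∑ x ∈ K, (G.totalWeight x + c x) * |f x| ^ p

theorem energy_eq_finiteEnergy (G : WeightedGraph X) {p : ℝ} (hp : 1 < p) (c : X → ℝ) {f : X → ℝ}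
    {K : Finset X} (hf : ∀ x ∉ K, f x = 0) : G.energy p c f = G.finiteEnergy p c K f := by
  have h0 : (0 : ℝ) ^ p = 0 := Real.zero_rpow (by linarith)
  have hg : ∀ x ∉ K, |f x| ^ p = 0 := fun x hx => by rw [hf x hx, abs_zero, h0]
  have h1 : HasSum (fun z : X × X => G.b z.1 z.2 * (|f z.1 - f z.2| ^ p - |f z.1| ^ p - |f z.2| ^ p))
      (∑ z ∈ K ×ˢ K, G.b z.1 z.2 * (|f z.1 - f z.2| ^ p - |f z.1| ^ p - |f z.2| ^ p)) := by
    refine hasSum_sum_of_ne_finset_zero fun z hz => ?_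
    rw [Finset.mem_product, not_and_or] at hz
    rcases hz with hz | hz <;> simp [hf _ hz, h0]
  have h2 := G.hasSum_mul_fst hg
  have h3 : HasSum (fun z : X × X => G.b z.1 z.2 * |f z.2| ^ p)
      (∑ x ∈ K, G.totalWeight x * |f x| ^ p) := by
    refine Eq.mp (congrArg (HasSum · _) (funext fun z => ?_)) ((Equiv.prodComm X X).hasSum_iff.2 h2)
    simp [G.b_symm z.1 z.2]
  have h4 := (h1.add h2).add h3
  have h5 : ∑' z : X × X, G.b z.1 z.2 * |f z.1 - f z.2| ^ p = _ :=
    HasSum.tsum_eq (by convert h4 using 2; ring)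
  rw [energy, finiteEnergy, h5, tsum_eq_sum (s := K) fun x hx => by rw [hg x hx, mul_zero]]
  simp only [add_mul, Finset.sum_add_distrib]
  ring

theorem continuous_finiteEnergy (G : WeightedGraph X) {p : ℝ} (hp : 1 < p) (c : X → ℝ)
    (K : Finset X) : Continuous (G.finiteEnergy p c K) := by
  have hp' : 0 ≤ p := by linarith
  have hr := Real.continuous_rpow_const hp'
  unfold finiteEnergy
  have h1 : ∀ x : X, Continuous fun f : X → ℝ => |f x| ^ p := fun x =>
    hr.comp (continuous_apply x).abs
  have h2 : ∀ x y : X, Continuous fun f : X → ℝ => |f x - f y| ^ p := fun x y =>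
    hr.comp ((continuous_apply x).sub (continuous_apply y)).abs
  refine (continuous_const.mul (continuous_finsetSum _ fun z _ => continuous_const.mul
    (((h2 _ _).sub (h1 _)).sub (h1 _)))).add (continuous_finsetSum _ fun x _ =>
      continuous_const.mul (h1 x))

theorem mem_formalSpace_of_finite_support (G : WeightedGraph X) {p : ℝ} {f : X → ℝ}
    {K : Finset X} (hf : ∀ x ∉ K, f x = 0) (V : Set X) : f ∈ G.formalSpace p V := by
  intro x _
  have h1 : Summable fun y => G.b x y * (|f x - f y| ^ (p - 1) - |f x| ^ (p - 1)) :=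
    summable_of_ne_finset_zero (s := K) fun y hy => by simp [hf y hy]
  exact (h1.add ((G.b_summable x).mul_right (|f x| ^ (p - 1)))).congr fun y => by ring

theorem m_mul_schrodinger_of_finite_support (G : WeightedGraph X) {p : ℝ} (c : X → ℝ)
    {f : X → ℝ} {K : Finset X} (hf : ∀ x ∉ K, f x = 0) (x : X) :
    G.m x * G.schrodinger p c f x =
      ∑ y ∈ K, G.b x y * (signedPow p (f x - f y) - signedPow p (f x)) +
        (G.totalWeight x + c x) * signedPow p (f x) := by
  have h1 : HasSum (fun y => G.b x y * (signedPow p (f x - f y) - signedPow p (f x)))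
      (∑ y ∈ K, G.b x y * (signedPow p (f x - f y) - signedPow p (f x))) :=
    hasSum_sum_of_ne_finset_zero fun y hy => by simp [hf y hy]
  have h2 := h1.add ((G.b_summable x).hasSum.mul_right (signedPow p (f x)))
  have h3 : ∑' y, G.b x y * signedPow p (f x - f y) = _ :=
    HasSum.tsum_eq (by convert h2 using 2; ring)
  rw [m_mul_schrodinger, h3, totalWeight]
  ring

/-- First variation of the energy: its derivative at `f` in the direction `g` is
`p ∑ g m Hf`. -/
theorem hasDerivAt_energy (G : WeightedGraph X) {p : ℝ} (hp : 1 < p) (c : X → ℝ) {f g : X → ℝ}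
    {K : Finset X} (hf : ∀ x ∉ K, f x = 0) (hg : ∀ x ∉ K, g x = 0) :
    HasDerivAt (fun t : ℝ => G.energy p c fun x => f x + t * g x)
      (p * ∑ x ∈ K, g x * (G.m x * G.schrodinger p c f x)) 0 := by
  have hE : (fun t : ℝ => G.energy p c fun x => f x + t * g x) =
      fun t : ℝ => G.finiteEnergy p c K fun x => f x + t * g x := funext fun t =>
    G.energy_eq_finiteEnergy hp c fun x hx => by rw [hf x hx, hg x hx]; ring
  have hlin : ∀ a d : ℝ, HasDerivAt (fun t : ℝ => |a + t * d| ^ p) (p * signedPow p a * d) 0 := by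
    intro a d
    have h1 : HasDerivAt (fun t : ℝ => a + t * d) d 0 := by
      simpa using ((hasDerivAt_id (0 : ℝ)).mul_const d).const_add a
    have h2 : HasDerivAt (fun x : ℝ => |x| ^ p) (p * signedPow p a) (a + 0 * d) := by
      simpa using hasDerivAt_abs_rpow_signedPow hp a
    exact h2.comp (0 : ℝ) h1
  have hdiff : ∀ z : X × X, HasDerivAt
      (fun t : ℝ => |(f z.1 + t * g z.1) - (f z.2 + t * g z.2)| ^ p)
      (p * signedPow p (f z.1 - f z.2) * (g z.1 - g z.2)) 0 := by
    intro z
    convert hlin (f z.1 - f z.2) (g z.1 - g z.2) using 4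
    ring
  have h := ((HasDerivAt.fun_sum (u := K ×ˢ K) fun z _ => (((hdiff z).sub (hlin (f z.1) (g z.1))).sub
      (hlin (f z.2) (g z.2))).const_mul (G.b z.1 z.2)).const_mul (1 / 2)).add
    (HasDerivAt.fun_sum (u := K) fun x _ => (hlin (f x) (g x)).const_mul (G.totalWeight x + c x))
  rw [hE]
  refine HasDerivAt.congr_deriv h ?_
  simp only [G.m_mul_schrodinger_of_finite_support c hf, mul_add, Finset.mul_sum,
    Finset.sum_add_distrib, Finset.sum_product]
  congr 1
  · -- both sides agree after symmetrizing the sum over ordered pairs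
    have hsw : ∑ x ∈ K, ∑ y ∈ K, p * (g x * (G.b x y * (signedPow p (f x - f y) - signedPow p (f x)))) =
        ∑ x ∈ K, ∑ y ∈ K, p * (g y * (G.b x y * (-signedPow p (f x - f y) - signedPow p (f y)))) := by
      rw [Finset.sum_comm]
      refine Finset.sum_congr rfl fun x _ => Finset.sum_congr rfl fun y _ => ?_
      rw [G.b_symm y x, ← signedPow_neg, neg_sub]
    have : ∀ A B : ℝ, A = B → ∀ D : ℝ, D = 1 / 2 * (A + B) → D = A := by
      intro A B h D hD; linarith
    refine this _ _ hsw _ ?_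
    rw [← Finset.sum_add_distrib, Finset.mul_sum]
    refine Finset.sum_congr rfl fun x _ => ?_
    rw [← Finset.sum_add_distrib, Finset.mul_sum]
    refine Finset.sum_congr rfl fun y _ => ?_
    ring
  · refine Finset.sum_congr rfl fun x _ => ?_
    ring

theorem energy_mul (G : WeightedGraph X) (p : ℝ) (c : X → ℝ) (f : X → ℝ) (t : ℝ) :
    G.energy p c (fun x => t * f x) = |t| ^ p * G.energy p c f := by
  have h1 : ∀ a : ℝ, |t * a| ^ p = |t| ^ p * |a| ^ p := fun a => by
    rw [abs_mul, Real.mul_rpow (abs_nonneg _) (abs_nonneg _)]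
  simp only [energy, ← mul_sub, h1, mul_left_comm _ (|t| ^ p), tsum_mul_left]
  ring

/-- Green's formula `h(f) = ∑ f m Hf`, which is Euler's identity for the `p`-homogeneous energy. -/
theorem energy_eq_sum (G : WeightedGraph X) {p : ℝ} (hp : 1 < p) (c : X → ℝ) {f : X → ℝ}
    {K : Finset X} (hf : ∀ x ∉ K, f x = 0) :
    G.energy p c f = ∑ x ∈ K, f x * (G.m x * G.schrodinger p c f x) := by
  have h1 := G.hasDerivAt_energy hp c hf hf
  have h2 : HasDerivAt (fun t : ℝ => |1 + t| ^ p * G.energy p c f) (p * G.energy p c f) 0 := by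
    have h3 : HasDerivAt (fun x : ℝ => |x| ^ p) (p * signedPow p 1) (1 + 0) := by
      simpa using hasDerivAt_abs_rpow_signedPow hp 1
    have h4 := (h3.comp (0 : ℝ) ((hasDerivAt_id (0 : ℝ)).const_add 1)).mul_const (G.energy p c f)
    simpa [signedPow] using h4
  have h5 : (fun t : ℝ => G.energy p c fun x => f x + t * f x) =
      fun t : ℝ => |1 + t| ^ p * G.energy p c f := funext fun t => by
    rw [← energy_mul]; congr 1; ext x; ring
  rw [h5] at h1
  exact mul_left_cancel₀ (by linarith) (h2.unique h1)

theorem energy_abs_le (G : WeightedGraph X) {p : ℝ} (hp : 1 < p) (c : X → ℝ) {f : X → ℝ}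
    (hf : f ∈ finSupp (Set.univ : Set X)) : G.energy p c (fun x => |f x|) ≤ G.energy p c f := by
  have hfa : (fun x => |f x|) ∈ finSupp (Set.univ : Set X) :=
    ⟨hf.1.subset fun x hx h => by simp [h] at hx, Set.subset_univ _⟩
  have h1 := (G.finSupp_subset_energyDomain hp c _ hf).1
  have h2 := (G.finSupp_subset_energyDomain hp c _ hfa).1
  have h4 : ∀ a d : ℝ, |(|a| - |d|)| ^ p ≤ |a - d| ^ p := fun a d =>
    Real.rpow_le_rpow (abs_nonneg _) (abs_abs_sub_abs_le a d) (by linarith)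
  have h3 : ∑' z : X × X, G.b z.1 z.2 * |(|f z.1| - |f z.2|)| ^ p ≤
      ∑' z : X × X, G.b z.1 z.2 * |f z.1 - f z.2| ^ p :=
    h2.tsum_le_tsum (fun z => mul_le_mul_of_nonneg_left (h4 _ _) (G.b_nonneg z.1 z.2)) h1
  simp only [energy, abs_abs]
  linarith

theorem mem_finSupp_univ {f : X → ℝ} {K : Finset X} (hf : ∀ x ∉ K, f x = 0) :
    f ∈ finSupp (Set.univ : Set X) :=
  ⟨K.finite_toSet.subset fun x hx => by_contra fun h => hx (hf x h), Set.subset_univ _⟩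

/-- Euler–Lagrange equation at `x`. -/
theorem schrodinger_eq_zero_of_energy_le (G : WeightedGraph X) {p : ℝ} (hp : 1 < p) (c : X → ℝ)
    {f : X → ℝ} {K : Finset X} (hf : ∀ x ∉ K, f x = 0) {x : X} (hx : x ∈ K)
    (hmin : ∀ g : X → ℝ, (∀ y ≠ x, g y = f y) → G.energy p c f ≤ G.energy p c g) :
    G.schrodinger p c f x = 0 := by
  classical
  have h := G.hasDerivAt_energy hp c hf (g := Pi.single x 1) fun y hy =>
    Pi.single_eq_of_ne (fun e : y = x => hy (e ▸ hx)) _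
  have hloc : IsLocalMin (fun t : ℝ => G.energy p c fun y => f y + t * (Pi.single x 1 : X → ℝ) y) 0 :=
    Filter.Eventually.of_forall fun t => by
      simp only [zero_mul, add_zero]
      exact hmin _ fun y hy => by simp [Pi.single_eq_of_ne hy]
  have h0 := hloc.hasDerivAt_eq_zero h
  rw [Finset.sum_eq_single_of_mem x hx fun y _ hy => by simp [Pi.single_eq_of_ne hy]] at h0
  simpa [(G.m_pos x).ne', (by linarith : p ≠ 0)] using h0

open Filter Topology

/-! ### Equilibrium potentials of finite sets -/

/-- On an infinite connected graph a non-negative energy is strictly positive on non-zero finitely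
supported `f`: otherwise `|f|` would be a minimiser, hence harmonic, hence nowhere zero. -/
theorem energy_pos [Infinite X] (G : WeightedGraph X) {p : ℝ} (hp : 1 < p) {c : X → ℝ}
    (hh : G.IsNonnegOn p c Set.univ) {f : X → ℝ} {K : Finset X} (hf : ∀ x ∉ K, f x = 0)
    (hne : ∃ x, f x ≠ 0) : 0 < G.energy p c f := by
  classical
  by_contra! hle
  have habs := (G.energy_abs_le hp c (mem_finSupp_univ hf)).trans hle
  have hfa : ∀ x ∉ K, |f x| = 0 := fun x hx => by rw [hf x hx, abs_zero]
  have hH : ∀ x, G.schrodinger p c (fun x => |f x|) x = 0 := fun x => by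
    refine G.schrodinger_eq_zero_of_energy_le hp c (K := insert x K)
      (fun y hy => hfa y fun h => hy (Finset.mem_insert_of_mem h)) (Finset.mem_insert_self _ _)
      fun g hg => habs.trans (hh g ?_)
    refine mem_finSupp_univ (K := insert x K) fun y hy => ?_
    rw [Finset.mem_insert, not_or] at hy
    rw [hg y hy.1, hfa y hy.2]
  obtain ⟨z, hz⟩ := hne
  have hpos := G.pos_of_isSuperharmonicOn hp (c := c) (v := fun x => |f x|) (K := ∅)
    ⟨fun x _ => abs_nonneg _, z, trivial, abs_ne_zero.2 hz⟩
    ⟨G.mem_formalSpace_of_finite_support hfa _, fun x _ => (hH x).ge⟩ (by simp)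
  obtain ⟨y, hy⟩ := Infinite.exists_notMem_finset K
  exact (hpos y).ne' (hfa y hy)

theorem isCompact_setOf_abs_le (K : Finset X) (R : ℝ) :
    IsCompact {f : X → ℝ | (∀ x ∉ K, f x = 0) ∧ ∀ x, |f x| ≤ R} := by
  refine (isCompact_univ_pi fun _ : X => isCompact_Icc (a := -R) (b := R)).of_isClosed_subset ?_ ?_
  · simp only [Set.ofPred_and, Set.ofPred_forall]
    refine (isClosed_iInter fun x => isClosed_iInter fun _ =>
      isClosed_eq (continuous_apply x) continuous_const).inter (isClosed_iInter fun x =>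
      isClosed_le (continuous_apply x).abs continuous_const)
  · rintro f ⟨-, hf⟩ x -
    exact abs_le.1 (hf x)

/-- Coercivity of the energy on functions supported in a finite set. -/
theorem exists_mul_le_energy [Infinite X] (G : WeightedGraph X) {p : ℝ} (hp : 1 < p) {c : X → ℝ}
    (hh : G.IsNonnegOn p c Set.univ) {K : Finset X} (hK : K.Nonempty) :
    ∃ ε > 0, ∀ f : X → ℝ, (∀ x ∉ K, f x = 0) → ∀ x, ε * |f x| ^ p ≤ G.energy p c f := by
  classical
  have hp0 : 0 ≤ p := by linarith
  set S : Set (X → ℝ) := {f | (∀ x ∉ K, f x = 0) ∧ ∀ x, |f x| ≤ 1} ∩ ⋃ x ∈ K, {f | |f x| = 1} with hS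
  have hScompact : IsCompact S := (isCompact_setOf_abs_le K 1).inter_right
    (isClosed_biUnion_finset fun x _ => isClosed_eq (continuous_apply x).abs continuous_const)
  obtain ⟨o, ho⟩ := hK
  have hSne : S.Nonempty := by
    refine ⟨Pi.single o 1, ⟨fun x hx => Pi.single_eq_of_ne (fun e : x = o => hx (e ▸ ho)) _,
      fun x => ?_⟩, Set.mem_biUnion ho (by simp)⟩
    by_cases h : x = o
    · subst h; simp
    · simp [Pi.single_eq_of_ne h]
  obtain ⟨g, hgS, hgmin⟩ := hScompact.exists_isMinOn hSne (G.continuous_finiteEnergy hp c K).continuousOn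
  have hgpos : 0 < G.finiteEnergy p c K g := by
    rw [← G.energy_eq_finiteEnergy hp c hgS.1.1]
    refine G.energy_pos hp hh hgS.1.1 ?_
    obtain ⟨x, hx, hgx⟩ := Set.mem_iUnion₂.1 hgS.2
    exact ⟨x, fun h => by simp [h] at hgx⟩
  refine ⟨_, hgpos, fun f hf x => ?_⟩
  obtain ⟨a, haK, hmax⟩ := Finset.exists_max_image K (fun y => |f y|) ⟨o, ho⟩
  have hmax' : ∀ y, |f y| ≤ |f a| := fun y => by
    by_cases hy : y ∈ K
    · exact hmax y hy
    · rw [hf y hy, abs_zero]; exact abs_nonneg _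
  rcases (abs_nonneg (f a)).eq_or_lt with h0 | h0
  · have hx0 : |f x| = 0 := le_antisymm (h0 ▸ hmax' x) (abs_nonneg _)
    rw [hx0, Real.zero_rpow (by linarith), mul_zero]
    exact hh f (mem_finSupp_univ hf)
  · have hscale : (fun y => |f a|⁻¹ * f y) ∈ S := by
      refine ⟨⟨fun y hy => by simp [hf y hy], fun y => ?_⟩, Set.mem_biUnion haK ?_⟩
      · rw [abs_mul, abs_inv, abs_abs]
        exact inv_mul_le_one_of_le₀ (hmax' y) h0.le
      · rw [Set.mem_ofPred_eq, abs_mul, abs_inv, abs_abs, inv_mul_cancel₀ h0.ne']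
    have h1 : G.finiteEnergy p c K g ≤ G.finiteEnergy p c K fun y => |f a|⁻¹ * f y := hgmin hscale
    rw [← G.energy_eq_finiteEnergy hp c hscale.1.1, energy_mul, abs_inv, abs_abs,
      Real.inv_rpow h0.le] at h1
    have h2 : 0 < |f a| ^ p := Real.rpow_pos_of_pos h0 p
    rw [inv_mul_eq_div, le_div_iff₀ h2] at h1
    exact (mul_le_mul_of_nonneg_left (Real.rpow_le_rpow (abs_nonneg _) (hmax' x) hp0) hgpos.le).trans h1

theorem exists_minimizer [Infinite X] (G : WeightedGraph X) {p : ℝ} (hp : 1 < p) {c : X → ℝ}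
    (hh : G.IsNonnegOn p c Set.univ) {K : Finset X} {o : X} (ho : o ∈ K) :
    ∃ u : X → ℝ, (∀ x, 0 ≤ u x) ∧ (∀ x ∉ K, u x = 0) ∧ u o = 1 ∧
      ∀ g : X → ℝ, (∀ x ∉ K, g x = 0) → g o = 1 → G.energy p c u ≤ G.energy p c g := by
  classical
  have hp0 : 0 < p := by linarith
  obtain ⟨ε, hε, hcoer⟩ := G.exists_mul_le_energy hp hh ⟨o, ho⟩
  set e : X → ℝ := Pi.single o 1 with he
  have heo : e o = 1 := by simp [he]
  have heK : ∀ x ∉ K, e x = 0 := fun x hx => Pi.single_eq_of_ne (fun h : x = o => hx (h ▸ ho)) _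
  set R := (G.energy p c e / ε) ^ p⁻¹ with hR
  -- competitors with less energy than the point mass at `o` lie in the box `|g| ≤ R`
  have hbox : ∀ g : X → ℝ, (∀ x ∉ K, g x = 0) → G.energy p c g ≤ G.energy p c e →
      ∀ x, |g x| ≤ R := by
    intro g hg hge x
    have h1 : |g x| ^ p ≤ G.energy p c e / ε := (le_div_iff₀' hε).2 ((hcoer g hg x).trans hge)
    rw [← Real.rpow_rpow_inv (abs_nonneg (g x)) hp0.ne']
    exact Real.rpow_le_rpow (by positivity) h1 (by positivity)
  have hcomp : IsCompact ({f : X → ℝ | (∀ x ∉ K, f x = 0) ∧ ∀ x, |f x| ≤ R} ∩ {f | f o = 1}) :=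
    (isCompact_setOf_abs_le K R).inter_right (isClosed_eq (continuous_apply o) continuous_const)
  obtain ⟨f, ⟨⟨hfK, -⟩, hfo⟩, hmin⟩ := hcomp.exists_isMinOn ⟨e, ⟨heK, hbox e heK le_rfl⟩, heo⟩
    (G.continuous_finiteEnergy hp c K).continuousOn
  have hmin' : ∀ g : X → ℝ, (∀ x ∉ K, g x = 0) → g o = 1 → G.energy p c g ≤ G.energy p c e →
      G.energy p c f ≤ G.energy p c g := by
    intro g hg hgo hge
    rw [G.energy_eq_finiteEnergy hp c hfK, G.energy_eq_finiteEnergy hp c hg]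
    exact hmin ⟨⟨hg, hbox g hg hge⟩, hgo⟩
  refine ⟨fun x => |f x|, fun x => abs_nonneg _, fun x hx => by simp [hfK x hx],
    by simp [show f o = 1 from hfo], fun g hg hgo => ?_⟩
  refine (G.energy_abs_le hp c (mem_finSupp_univ hfK)).trans ?_
  rcases le_total (G.energy p c g) (G.energy p c e) with h | h
  · exact hmin' g hg hgo h
  · exact (hmin' e heK heo le_rfl).trans h

/-- `u` is an equilibrium potential of `o` in the finite set `K`: a non-negative minimiser of the
energy among the functions supported in `K` that are `1` at `o`. The Euler–Lagrange equation off
`o` and the value of `Hu(o)`, which follow from minimality, are recorded as fields. -/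
structure IsEquilibrium (G : WeightedGraph X) (p : ℝ) (c : X → ℝ) (K : Finset X) (o : X)
    (u : X → ℝ) : Prop where
  nonneg : ∀ x, 0 ≤ u x
  eq_zero : ∀ x ∉ K, u x = 0
  eq_one : u o = 1
  energy_le : ∀ g : X → ℝ, (∀ x ∉ K, g x = 0) → g o = 1 → G.energy p c u ≤ G.energy p c g
  harmonic : ∀ x ∈ K, x ≠ o → G.schrodinger p c u x = 0
  energy_eq : G.m o * G.schrodinger p c u o = G.energy p c u

theorem exists_isEquilibrium [Infinite X] (G : WeightedGraph X) {p : ℝ} (hp : 1 < p) {c : X → ℝ}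
    (hh : G.IsNonnegOn p c Set.univ) {K : Finset X} {o : X} (ho : o ∈ K) :
    ∃ u, G.IsEquilibrium p c K o u := by
  obtain ⟨u, h0, hK, h1, hmin⟩ := G.exists_minimizer hp hh ho
  have hH : ∀ x ∈ K, x ≠ o → G.schrodinger p c u x = 0 := fun x hx hxo =>
    G.schrodinger_eq_zero_of_energy_le hp c hK hx fun g hg =>
      hmin g (fun y hy => by rw [hg y fun e => hy (e ▸ hx), hK y hy]) (by rw [hg o hxo.symm, h1])
  refine ⟨u, h0, hK, h1, hmin, hH, ?_⟩
  rw [G.energy_eq_sum hp c hK, Finset.sum_eq_single_of_mem o ho fun x hx hxo => by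
    rw [hH x hx hxo, mul_zero, mul_zero], h1, one_mul]

/-- Every vertex of `K` is the end of a path in `K` that starts at `o`. -/
def ConnectedFrom (G : WeightedGraph X) (o : X) (K : Finset X) : Prop :=
  ∀ x ∈ K, Relation.ReflTransGen (fun a d => 0 < G.b a d ∧ d ∈ K) o x

namespace IsEquilibrium

variable {G : WeightedGraph X} {p : ℝ} {c : X → ℝ} {K L : Finset X} {o : X} {u v : X → ℝ}

theorem isSuperharmonicOn (hu : G.IsEquilibrium p c K o u) (hh : G.IsNonnegOn p c Set.univ) :
    G.IsSuperharmonicOn p c K u := by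
  refine ⟨G.mem_formalSpace_of_finite_support hu.eq_zero _, fun x hx => ?_⟩
  by_cases hxo : x = o
  · subst hxo
    refine nonneg_of_mul_nonneg_right ?_ (G.m_pos x)
    rw [hu.energy_eq]
    exact hh u (mem_finSupp_univ hu.eq_zero)
  · exact (hu.harmonic x hx hxo).ge

theorem pos (hu : G.IsEquilibrium p c K o u) (hp : 1 < p) (hh : G.IsNonnegOn p c Set.univ)
    (hK : G.ConnectedFrom o K) {x : X} (hx : x ∈ K) : 0 < u x := by
  have hpath := hK x hx
  clear hx
  induction hpath with
  | refl => rw [hu.eq_one]; exact one_pos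
  | @tail a d _ had ih =>
    refine lt_of_le_of_ne (hu.nonneg d) fun h => ih.ne' ?_
    exact G.eq_zero_of_eq_zero hp hu.nonneg
      ((hu.isSuperharmonicOn hh).mono (by simpa using had.2)) h.symm (by rw [G.b_symm]; exact had.1)

theorem mono (hu : G.IsEquilibrium p c K o u) (hv : G.IsEquilibrium p c L o v) (hp : 1 < p)
    (hh : G.IsNonnegOn p c Set.univ) (ho : o ∈ K) (hK : G.ConnectedFrom o K)
    (hL : G.ConnectedFrom o L) (hKL : K ⊆ L) (x : X) : u x ≤ v x := by
  have hpos : ∀ y ∈ K, 0 < v y := fun y hy => hv.pos hp hh hL (hKL hy)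
  refine G.comparison hp (c := c) (K := ↑K \ {o}) (K.finite_toSet.sdiff)
    (G.mem_formalSpace_of_finite_support hu.eq_zero _)
    (fun y hy => (hu.harmonic y hy.1 hy.2).le)
    ((hv.isSuperharmonicOn hh).mono fun y hy => hKL hy.1) hv.nonneg (fun y hy => hpos y hy.1)
    (fun y hy => ?_) (fun y hy => ⟨o, fun h => h.2 rfl, ?_⟩) x
  · by_cases hyK : y ∈ K
    · have hyo : y = o := by_contra fun h => hy ⟨hyK, h⟩
      rw [hyo, hu.eq_one, hv.eq_one]
    · rw [hu.eq_zero y hyK]; exact hv.nonneg y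
  · -- the path from `o` to `y` in `K`, reversed
    suffices Relation.ReflTransGen (fun a d => 0 < G.b a d ∧ 0 < v d) y o ∧ 0 < v y from this.1
    have hpath := hK y hy.1
    clear hy
    induction hpath with
    | refl => exact ⟨.refl, hpos o ho⟩
    | @tail a d _ had ih =>
      exact ⟨ih.1.head ⟨by rw [G.b_symm]; exact had.1, ih.2⟩, hpos d had.2⟩

end IsEquilibrium

/-- An exhaustion of `X` by finite sets connected from `o`. -/
theorem exists_exhaustion [Countable X] (G : WeightedGraph X) (o : X) :
    ∃ K : ℕ → Finset X, Monotone K ∧ (∀ n, o ∈ K n) ∧ (∀ n, G.ConnectedFrom o (K n)) ∧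
      ∀ x, ∃ n, x ∈ K n := by
  classical
  have hA : ∀ x, ∃ A : Finset X, o ∈ A ∧ x ∈ A ∧ G.ConnectedFrom o A := by
    intro x
    induction G.connected o x with
    | refl =>
      refine ⟨{o}, by simp, by simp, fun y hy => ?_⟩
      rw [Finset.mem_singleton.1 hy]
    | @tail a d _ had ih =>
      obtain ⟨A, hoA, haA, hA⟩ := ih
      have hmono : ∀ y ∈ A, Relation.ReflTransGen (fun a e => 0 < G.b a e ∧ e ∈ insert d A) o y :=
        fun y hy => Relation.ReflTransGen.mono (fun _ _ h => ⟨h.1, Finset.mem_insert_of_mem h.2⟩) _ _ (hA y hy)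
      refine ⟨insert d A, Finset.mem_insert_of_mem hoA, Finset.mem_insert_self _ _, fun y hy => ?_⟩
      rcases Finset.mem_insert.1 hy with rfl | hy
      · exact (hmono a haA).tail ⟨had, Finset.mem_insert_self _ _⟩
      · exact hmono y hy
  choose A hoA hxA hA using hA
  have : Nonempty X := ⟨o⟩
  obtain ⟨e, he⟩ := exists_surjective_nat X
  refine ⟨fun n => (Finset.range (n + 1)).biUnion fun i => A (e i), fun n k hnk => ?_, fun n => ?_,
    fun n x hx => ?_, fun x => ?_⟩
  · exact Finset.biUnion_subset_biUnion_of_subset_left _ (Finset.range_mono (by omega))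
  · exact Finset.mem_biUnion.2 ⟨0, by simp, hoA _⟩
  · obtain ⟨i, hi, hx⟩ := Finset.mem_biUnion.1 hx
    exact Relation.ReflTransGen.mono (fun _ _ h => ⟨h.1, Finset.mem_biUnion.2 ⟨i, hi, h.2⟩⟩) _ _
      (hA _ x hx)
  · obtain ⟨n, rfl⟩ := he x
    exact ⟨n, Finset.mem_biUnion.2 ⟨n, by simp, hxA _⟩⟩

/-! ### The equilibrium potential of a vertex -/

theorem bddBelow_energy_image (G : WeightedGraph X) {p : ℝ} {c : X → ℝ}
    (hh : G.IsNonnegOn p c Set.univ) (o : X) :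
    BddBelow (G.energy p c '' {φ | φ ∈ finSupp Set.univ ∧ φ o = 1}) :=
  ⟨0, by rintro _ ⟨φ, hφ, rfl⟩; exact hh φ hφ.1⟩

theorem capacity_le_energy (G : WeightedGraph X) {p : ℝ} {c : X → ℝ}
    (hh : G.IsNonnegOn p c Set.univ) {o : X} {φ : X → ℝ} (hφ : φ ∈ finSupp (Set.univ : Set X))
    (ho : φ o = 1) : G.capacity p c o Set.univ ≤ G.energy p c φ :=
  csInf_le (G.bddBelow_energy_image hh o) ⟨φ, ⟨hφ, ho⟩, rfl⟩

theorem le_capacity (G : WeightedGraph X) {p : ℝ} {c : X → ℝ} {o : X} {a : ℝ}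
    (h : ∀ φ ∈ finSupp (Set.univ : Set X), φ o = 1 → a ≤ G.energy p c φ) :
    a ≤ G.capacity p c o Set.univ := by
  classical
  refine le_csInf ?_ (by rintro _ ⟨φ, hφ, rfl⟩; exact h φ hφ.1 hφ.2)
  exact ⟨_, Pi.single o 1, ⟨mem_finSupp_univ (K := {o}) fun x hx =>
    Pi.single_eq_of_ne (by simpa using hx) _, by simp⟩, rfl⟩

/-- The equilibrium potential of `o` in `X`, the increasing limit of the equilibrium potentials of
an exhaustion: it satisfies `m(o) Hu = cap(o) 1_o` and has minimal growth off `o`. -/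
theorem exists_potential [Countable X] [Infinite X] (G : WeightedGraph X) {p : ℝ} (hp : 1 < p)
    {c : X → ℝ} (hh : G.IsNonnegOn p c Set.univ) (o : X) :
    ∃ u : X → ℝ, (∀ x, 0 < u x) ∧ u o = 1 ∧ u ∈ G.formalSpace p Set.univ ∧
      (∀ x ≠ o, G.schrodinger p c u x = 0) ∧
      G.m o * G.schrodinger p c u o = G.capacity p c o Set.univ ∧
      G.IsMinimalGrowth p c Set.univ {o} u := by
  obtain ⟨K, hKmono, hoK, hKconn, hKex⟩ := G.exists_exhaustion o
  choose u hu using fun n => G.exists_isEquilibrium hp hh (hoK n)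
  have hev : ∀ x, ∀ᶠ n in atTop, x ∈ K n := fun x => by
    obtain ⟨n, hn⟩ := hKex x
    exact eventually_atTop.2 ⟨n, fun k hk => hKmono hk hn⟩
  have humono : ∀ {n k}, n ≤ k → ∀ x, u n x ≤ u k x := fun hnk =>
    (hu _).mono (hu _) hp hh (hoK _) (hKconn _) (hKconn _) (hKmono hnk)
  have hsuper : ∀ x, ∀ᶠ n in atTop, G.IsSuperharmonicOn p c {x} (u n) := fun x =>
    (hev x).mono fun n hn => ((hu n).isSuperharmonicOn hh).mono (by simpa using hn)
  have hbdd : ∀ x, ∃ M, ∀ n, u n x ≤ M := by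
    intro x
    induction G.connected o x with
    | refl => exact ⟨1, fun n => (hu n).eq_one.le⟩
    | @tail a d _ had ih =>
      obtain ⟨M, hM⟩ := ih
      obtain ⟨M', hM'⟩ := G.exists_le_of_adj hp c had M
      refine ⟨M', fun n => ?_⟩
      obtain ⟨k, hk, hnk⟩ := ((hsuper a).and (eventually_ge_atTop n)).exists
      exact (humono hnk d).trans (hM' (u k) (hu k).nonneg hk (hM k))
  have hbdd' : ∀ x, BddAbove (Set.range fun n => u n x) := fun x => by
    obtain ⟨M, hM⟩ := hbdd x
    exact ⟨M, by rintro _ ⟨n, rfl⟩; exact hM n⟩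
  set w : X → ℝ := fun x => ⨆ n, u n x with hw
  have hle : ∀ n x, u n x ≤ w x := fun n x => le_ciSup (hbdd' x) n
  have hlim : ∀ x, Tendsto (fun n => u n x) atTop (𝓝 (w x)) := fun x =>
    tendsto_atTop_ciSup (fun n k hnk => humono hnk x) (hbdd' x)
  have hwpos : ∀ x, 0 < w x := fun x => by
    obtain ⟨n, hn⟩ := hKex x
    exact ((hu n).pos hp hh (hKconn n) hn).trans_le (hle n x)
  have hwo : w o = 1 := by simp [hw, (hu _).eq_one]
  have hT := fun x => G.tendsto_schrodinger hp (fun n => (hu n).nonneg) hle hlim (hsuper x)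
  have hwF : w ∈ G.formalSpace p Set.univ := fun x _ => (hT x).1 x rfl
  have hwH : ∀ x ≠ o, G.schrodinger p c w x = 0 := fun x hx =>
    tendsto_nhds_unique (hT x).2 (tendsto_const_nhds.congr' ((hev x).mono fun n hn =>
      ((hu n).harmonic x hn hx).symm))
  have hen : Tendsto (fun n => G.energy p c (u n)) atTop (𝓝 (G.m o * G.schrodinger p c w o)) :=
    ((hT o).2.const_mul (G.m o)).congr fun n => (hu n).energy_eq
  refine ⟨w, hwpos, hwo, hwF, hwH, le_antisymm (G.le_capacity fun φ hφ hφo => ?_) ?_,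
    ⟨fun x _ => hwF x trivial, fun x hx => hwH x hx.2⟩,
    ⟨fun x _ => (hwpos x).le, o, Or.inl trivial, (hwpos o).ne'⟩, ?_⟩
  · refine le_of_tendsto hen ?_
    filter_upwards [(eventually_all_finite hφ.1).2 fun x _ => hev x] with n hn
    exact (hu n).energy_le φ (fun x hx => by_contra fun h => hx (hn x h)) hφo
  · exact ge_of_tendsto' hen fun n =>
      G.capacity_le_energy hh (mem_finSupp_univ (hu n).eq_zero) (hu n).eq_one
  · intro K' hK'fin _ _ _ hoK' v hv0 hv huv x hx
    have hoK' : o ∈ K' := hoK' rfl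
    have hvpos := G.pos_of_isSuperharmonicOn hp hv0 hv fun y hy => (hwpos y).trans_le (huv y hy)
    refine le_of_tendsto' (hlim x) fun n => ?_
    refine G.comparison hp (c := c) (K := ↑(K n) \ K') (K n).finite_toSet.sdiff
      (G.mem_formalSpace_of_finite_support (hu n).eq_zero _)
      (fun y hy => ((hu n).harmonic y hy.1 fun h => hy.2 (h ▸ hoK')).le)
      (hv.mono fun y hy => ⟨trivial, hy.2⟩) (fun y => (hvpos y).le) (fun y _ => hvpos y)
      (fun y hy => ?_) (fun y _ => ⟨o, fun h => h.2 hoK',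
        Relation.ReflTransGen.mono (fun _ d h => ⟨h, hvpos d⟩) _ _ (G.connected y o)⟩) x
    by_cases hyK : y ∈ K n
    · exact (hle n y).trans (huv y (by_contra fun h => hy ⟨hyK, h⟩))
    · rw [(hu n).eq_zero y hyK]; exact (hvpos y).le

/-! ### Minimal growth and Agmon ground states -/

theorem isConnectedSet_singleton (G : WeightedGraph X) (o : X) : G.IsConnectedSet {o} := by
  rintro ⟨x, rfl⟩ ⟨y, rfl⟩
  exact .refl _

theorem IsMinimalGrowth.const_mul {G : WeightedGraph X} {p : ℝ} {c : X → ℝ} {K : Set X} {u : X → ℝ}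
    (hu : G.IsMinimalGrowth p c Set.univ K u) {t : ℝ} (ht : 0 < t) :
    G.IsMinimalGrowth p c Set.univ K fun x => t * u x := by
  obtain ⟨hharm, hpos, hmin⟩ := hu
  refine ⟨⟨mul_mem_formalSpace hharm.1 t, fun x hx => ?_⟩, hpos.const_mul ht, ?_⟩
  · rw [schrodinger_mul _ _ _ ht, hharm.2 x hx, mul_zero]
  · intro K' hfin hne hconn hV hK v hv0 hv huv x hx
    have h := hmin K' hfin hne hconn hV hK (fun x => t⁻¹ * v x) (hv0.const_mul (inv_pos.2 ht))
      (hv.const_mul (inv_pos.2 ht)) (fun y hy => (le_inv_mul_iff₀ ht).2 (huv y hy)) x hx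
    exact (le_inv_mul_iff₀ ht).1 h

/-- A positive harmonic function of minimal growth off at most one vertex `o` is an Agmon ground
state: if `v` is positive superharmonic and scaled so that `u(o) = v(o)`, then `u ≤ v` by
minimality, and the two touch at `o`. -/
theorem isAgmonGroundState_of_isMinimalGrowth (G : WeightedGraph X) {p : ℝ} (hp : 1 < p) {c : X → ℝ}
    {u : X → ℝ} {o : X} {K : Set X} (hK : K ⊆ {o}) (hpos : PositiveOn Set.univ u)
    (hharm : G.IsHarmonicOn p c Set.univ u) (hmin : G.IsMinimalGrowth p c Set.univ K u) :
    G.IsAgmonGroundState p c u := by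
  have hall : ∀ w : X → ℝ, PositiveOn Set.univ w → G.IsSuperharmonicOn p c Set.univ w →
      ∀ x, 0 < w x := fun w hw0 hw =>
    G.pos_of_isSuperharmonicOn hp (K := ∅) hw0 (hw.mono (Set.subset_univ _)) (by simp)
  refine ⟨hpos, hharm, fun v hv0 hv => ?_⟩
  have hu' := hall u hpos hharm.isSuperharmonicOn
  have hv' := hall v hv0 hv
  set t := u o / v o with ht
  have ht0 : 0 < t := div_pos (hu' o) (hv' o)
  have hto : u o = t * v o := (div_mul_cancel₀ _ (hv' o).ne').symm
  have htv := hv.const_mul ht0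
  have hle : ∀ x, u x ≤ t * v x := by
    intro x
    by_cases hx : x = o
    · rw [hx, ← hto]
    · exact hmin.2.2 {o} (Set.finite_singleton o) (Set.singleton_nonempty o)
        (G.isConnectedSet_singleton o) (Set.subset_univ _) hK _ (hv0.const_mul ht0)
        (htv.mono (Set.subset_univ _)) (by rintro _ rfl; exact hto.le) x ⟨trivial, hx⟩
  have heq := G.eq_of_touching_everywhere hp (c := c) hharm.1 htv.1 hle hto fun x =>
    (hharm.2 x trivial).trans_le (htv.2 x trivial)
  exact ⟨t⁻¹, fun x => by rw [heq x, inv_mul_cancel_left₀ ht0.ne']⟩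

theorem IsGlobalMinimal.isAgmonGroundState {G : WeightedGraph X} {p : ℝ} (hp : 1 < p) {c : X → ℝ}
    {u : X → ℝ} (hu : G.IsGlobalMinimal p c Set.univ u) : G.IsAgmonGroundState p c u := by
  obtain ⟨h0, o, -, ho⟩ := hu.2.1
  refine G.isAgmonGroundState_of_isMinimalGrowth hp (o := o) (Set.empty_subset _)
    ⟨fun x _ => h0 x (Or.inl trivial), o, trivial, ho⟩ ?_ hu
  simpa using hu.1

/-- An Agmon ground state is harmonic and proportional to every positive superharmonic function;
the factor is strictly positive. -/
theorem IsAgmonGroundState.exists_pos_mul {G : WeightedGraph X} {p : ℝ} {c : X → ℝ} {u v : X → ℝ}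
    (hu : G.IsAgmonGroundState p c u) (hv0 : PositiveOn Set.univ v)
    (hv : G.IsSuperharmonicOn p c Set.univ v) :
    ∃ a > 0, (v = fun x => a * u x) ∧ ∀ x, G.schrodinger p c v x = 0 := by
  obtain ⟨a, ha⟩ := hu.2.2 v hv0 hv
  obtain ⟨h0, x, -, hx⟩ := hv0
  have hapos : 0 < a := by
    by_contra! hle
    have h1 := h0 x trivial
    have h2 := hu.1.1 x trivial
    exact hx (le_antisymm (by rw [ha]; exact mul_nonpos_of_nonpos_of_nonneg hle h2) h1)
  obtain rfl : v = fun x => a * u x := funext ha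
  refine ⟨a, hapos, rfl, fun x => ?_⟩
  rw [schrodinger_mul _ _ _ hapos, hu.2.1.2 x trivial, mul_zero]

theorem capacity_nonneg (G : WeightedGraph X) {p : ℝ} {c : X → ℝ}
    (hh : G.IsNonnegOn p c Set.univ) (o : X) : 0 ≤ G.capacity p c o Set.univ :=
  G.le_capacity fun φ hφ _ => hh φ hφ

section

variable [Countable X] [Infinite X] {G : WeightedGraph X} {p : ℝ} {c : X → ℝ}

theorem exists_isAgmonGroundState_of_capacity_eq_zero (hp : 1 < p) (hh : G.IsNonnegOn p c Set.univ)
    {o : X} (ho : G.capacity p c o Set.univ = 0) : ∃ u, G.IsAgmonGroundState p c u := by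
  obtain ⟨u, hpos, -, hF, hH, hHo, hmin⟩ := G.exists_potential hp hh o
  refine ⟨u, G.isAgmonGroundState_of_isMinimalGrowth hp subset_rfl
    ⟨fun x _ => (hpos x).le, o, trivial, (hpos o).ne'⟩ ⟨hF, fun x _ => ?_⟩ hmin⟩
  by_cases hx : x = o
  · subst hx
    exact (mul_eq_zero.1 (hHo.trans ho)).resolve_left (G.m_pos x).ne'
  · exact hH x hx

/-- If `u` is an Agmon ground state, then the equilibrium potential of any vertex `o` is a positive
multiple of `u`; so `u` inherits its minimal growth off `o`, and the potential is harmonic at `o`. -/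
theorem IsAgmonGroundState.isMinimalGrowth_singleton (hp : 1 < p) (hh : G.IsNonnegOn p c Set.univ)
    {u : X → ℝ} (hu : G.IsAgmonGroundState p c u) (o : X) :
    G.IsMinimalGrowth p c Set.univ {o} u ∧ G.capacity p c o Set.univ = 0 := by
  obtain ⟨w, hpos, -, hF, hH, hHo, hmin⟩ := G.exists_potential hp hh o
  have hsuper : G.IsSuperharmonicOn p c Set.univ w := by
    refine ⟨hF, fun x _ => ?_⟩
    by_cases hx : x = o
    · subst hx
      exact nonneg_of_mul_nonneg_right (hHo ▸ G.capacity_nonneg hh x) (G.m_pos x)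
    · exact (hH x hx).ge
  obtain ⟨a, ha, rfl, hw⟩ := hu.exists_pos_mul
    ⟨fun x _ => (hpos x).le, o, trivial, (hpos o).ne'⟩ hsuper
  refine ⟨?_, by rw [← hHo, hw, mul_zero]⟩
  simpa [inv_mul_cancel_left₀ ha.ne'] using hmin.const_mul (inv_pos.2 ha)

theorem IsAgmonGroundState.isGlobalMinimal (hp : 1 < p) (hh : G.IsNonnegOn p c Set.univ)
    {u : X → ℝ} (hu : G.IsAgmonGroundState p c u) : G.IsGlobalMinimal p c Set.univ u := by
  obtain ⟨h0, o, -, ho⟩ := hu.1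
  refine ⟨by simpa using hu.2.1, ⟨fun x _ => ?_, o, Or.inl trivial, ho⟩, ?_⟩
  · exact h0 x trivial
  · intro K' hfin hne hconn hV _
    obtain ⟨o', ho'⟩ := hne
    exact (hu.isMinimalGrowth_singleton hp hh o').1.2.2 K' hfin ⟨o', ho'⟩ hconn hV (by simpa using ho')

/-- If `cap(o) > 0`, the equilibrium potential of `o`, suitably scaled, is a normalised
Green's function. -/
theorem exists_isNormalisedGreenFunction (hp : 1 < p) (hh : G.IsNonnegOn p c Set.univ) {o : X}
    (ho : 0 < G.capacity p c o Set.univ) : ∃ u, G.IsNormalisedGreenFunction p c Set.univ o u := by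
  obtain ⟨w, hpos, -, hF, hH, hHo, hmin⟩ := G.exists_potential hp hh o
  have hw : 0 < G.schrodinger p c w o := pos_of_mul_pos_right (hHo ▸ ho) (G.m_pos o).le
  set t := (G.schrodinger p c w o)⁻¹ ^ (p - 1)⁻¹ with ht
  have ht0 : 0 < t := Real.rpow_pos_of_pos (inv_pos.2 hw) _
  have htp : t ^ (p - 1) = (G.schrodinger p c w o)⁻¹ :=
    Real.rpow_inv_rpow (inv_pos.2 hw).le (by linarith)
  have hto : G.schrodinger p c (fun x => t * w x) o = 1 := by
    rw [schrodinger_mul _ _ _ ht0, htp, inv_mul_cancel₀ hw.ne']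
  refine ⟨fun x => t * w x, ⟨hmin.const_mul ht0, mul_mem_formalSpace hF t, fun h => ?_⟩,
    fun x _ => ?_⟩
  · exact one_ne_zero (hto.symm.trans (h.2 o rfl))
  · by_cases hx : x = o
    · subst hx
      rw [hto, Set.indicator_of_mem (Set.mem_singleton x)]
    · rw [schrodinger_mul _ _ _ ht0, hH x hx, mul_zero, Set.indicator_of_notMem (Set.notMem_singleton_iff.2 hx)]

end

/-! ### Capacity and Hardy weights -/

theorem tsum_mul_indicator_singleton (p a : ℝ) (φ : X → ℝ) (o : X) :
    ∑' x, |φ x| ^ p * Set.indicator {o} (fun _ => a) x = |φ o| ^ p * a := by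
  rw [tsum_eq_single o fun x hx => by
    rw [Set.indicator_of_notMem (Set.notMem_singleton_iff.2 hx), mul_zero],
    Set.indicator_of_mem (Set.mem_singleton o)]

/-- If `cap(o) > 0`, then `cap(o) 1_o` is a Hardy weight, by homogeneity of the energy. -/
theorem capacity_eq_zero_of_isCritical (G : WeightedGraph X) {p : ℝ} (hp : 1 < p) {c : X → ℝ}
    (hcrit : G.IsCritical p c Set.univ) (o : X) : G.capacity p c o Set.univ = 0 := by
  obtain ⟨hh, hno⟩ := hcrit
  by_contra hne
  have hcap := lt_of_le_of_ne (G.capacity_nonneg hh o) (Ne.symm hne)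
  refine hno ⟨Set.indicator {o} fun _ => G.capacity p c o Set.univ,
    ⟨fun x _ => Set.indicator_nonneg (fun _ _ => hcap.le) x, o, trivial, ?_⟩, fun φ hφ => ?_⟩
  · rwa [Set.indicator_of_mem (Set.mem_singleton o)]
  · rw [tsum_mul_indicator_singleton]
    by_cases h0 : φ o = 0
    · rw [h0, abs_zero, Real.zero_rpow (by linarith), zero_mul]
      exact hh φ hφ
    · have h1 := G.capacity_le_energy hh (o := o) (φ := fun x => (φ o)⁻¹ * φ x)
        ⟨hφ.1.subset fun x hx h => hx (by simp [h]), Set.subset_univ _⟩ (inv_mul_cancel₀ h0)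
      rw [energy_mul, abs_inv, Real.inv_rpow (abs_nonneg _)] at h1
      exact (le_inv_mul_iff₀ (Real.rpow_pos_of_pos (abs_pos.2 h0) p)).1 h1

theorem IsHardyWeight.exists_capacity_ne_zero {G : WeightedGraph X} {p : ℝ} (hp : 1 < p)
    {c : X → ℝ} {w : X → ℝ} (hw : G.IsHardyWeight p c Set.univ w) :
    ∃ o, G.capacity p c o Set.univ ≠ 0 := by
  obtain ⟨⟨h0, o, -, ho⟩, hle⟩ := hw
  have hwo : 0 < w o := lt_of_le_of_ne (h0 o trivial) (Ne.symm ho)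
  refine ⟨o, (hwo.trans_le (G.le_capacity fun φ hφ hφo => ?_)).ne'⟩
  have hs : Summable fun x => |φ x| ^ p * w x :=
    summable_of_ne_finset_zero (s := hφ.1.toFinset) fun x hx => by
      have hx0 : φ x = 0 := by simpa using hx
      rw [hx0, abs_zero, Real.zero_rpow (by linarith), zero_mul]
  have h1 := hs.le_tsum o fun x _ => mul_nonneg (Real.rpow_nonneg (abs_nonneg _) _) (h0 x trivial)
  rw [hφo, abs_one, Real.one_rpow, one_mul] at h1
  exact h1.trans (hle φ hφ)

end WeightedGraph

end

theorem theorem2p4 {X : Type*} [Countable X] [Infinite X] (G : WeightedGraph X)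
    (c : X → ℝ) (p : ℝ) (hp : 1 < p) (hh : G.IsNonnegOn p c Set.univ) :
    List.TFAE [
      G.IsCritical p c Set.univ,
      ∀ o : X, ¬ ∃ u : X → ℝ, G.IsNormalisedGreenFunction p c Set.univ o u,
      ∃ u : X → ℝ, G.IsGlobalMinimal p c Set.univ u,
      ∃ x : X, G.capacity p c x Set.univ = 0] ∧
    (G.IsCritical p c Set.univ →
      ∀ u : X → ℝ, G.IsGlobalMinimal p c Set.univ u ↔ G.IsAgmonGroundState p c u) := by
  obtain ⟨o⟩ : Nonempty X := inferInstance
  refine ⟨?_, fun _ u => ⟨fun h => h.isAgmonGroundState hp, fun h => h.isGlobalMinimal hp hh⟩⟩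
  tfae_have 1 → 4 := fun h => ⟨o, G.capacity_eq_zero_of_isCritical hp h o⟩
  tfae_have 4 → 1 := by
    rintro ⟨x, hx⟩
    obtain ⟨u, hu⟩ := WeightedGraph.exists_isAgmonGroundState_of_capacity_eq_zero hp hh hx
    refine ⟨hh, fun ⟨w, hw⟩ => ?_⟩
    obtain ⟨y, hy⟩ := hw.exists_capacity_ne_zero hp
    exact hy (hu.isMinimalGrowth_singleton hp hh y).2
  tfae_have 4 → 3 := by
    rintro ⟨x, hx⟩
    obtain ⟨u, hu⟩ := WeightedGraph.exists_isAgmonGroundState_of_capacity_eq_zero hp hh hx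
    exact ⟨u, hu.isGlobalMinimal hp hh⟩
  tfae_have 3 → 2 := by
    rintro ⟨u, hu⟩ x ⟨g, hg⟩
    -- a Green's function would be a positive superharmonic, non-harmonic function
    have hsuper : G.IsSuperharmonicOn p c Set.univ g :=
      ⟨hg.1.2.1, fun y hy => by
        rw [hg.2 y hy]; exact Set.indicator_nonneg (fun _ _ => zero_le_one) y⟩
    obtain ⟨h0, z, -, hz⟩ := hg.1.1.2.1
    obtain ⟨-, -, -, hharm⟩ := (hu.isAgmonGroundState hp).exists_pos_mul
      ⟨fun y _ => h0 y (Or.inl trivial), z, trivial, hz⟩ hsuper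
    exact hg.1.2.2 ⟨fun y _ => hg.1.2.1 y trivial, fun y _ => hharm y⟩
  tfae_have 2 → 4 := fun h => ⟨o, by
    by_contra hne
    exact h o (WeightedGraph.exists_isNormalisedGreenFunction hp hh
      (lt_of_le_of_ne (G.capacity_nonneg hh o) (Ne.symm hne)))⟩
  tfae_finish
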